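/- Let $K$ be a field of characteristic zero and let $A$ be an associative unital $K$-algebra. A (not necessarily commutative) Poisson structure on $A$ is a Lie bracket $\{-,-\}$ on $A$ over $K$ with $\{a,bc\}=\{a,b\}c+b\{a,c\}$. For such a structure let $U(A)$ be the universal enveloping algebra of the Lie algebra $(A,\{-,-\})$, with the coproduct $\Delta$ determined by $\Delta(x)=x\otimes 1+1\otimes x$ for $x\in A$; it acts on $A^e=A\otimes_K A^{\mathrm{op}}$ through $x\cdot(a\otimes b')=\{x,a\}\otimes b'+a\otimes\{x,b\}'$. The quasi-Poisson enveloping algebra is the smash product $\mathcal Q(A)=A^e\#U(A)$, i.e. the space $A^e\otimes_K U(A)$ with product $(r\#h)(s\#k)=\sum r\,(h_1\cdot s)\#h_2k$. The space $A$ is a left $\mathcal Q(A)$-module through $(a\otimes b'\#h)m=a\,(h\cdot m)\,b$, where $x\cdot m=\{x,m\}$ for $x\in A$, and the quasi-Poisson cohomology is $HQ^n(A)=\mathrm{Ext}^n_{\mathcal Q(A)}(A,A)$. Lemma. Let $\lambda\in K$ with $\lambda\neq 0$, and equip $A$ with the standard Poisson structure $\{a,b\}=\lambda(ab-ba)$.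 Then there is an isomorphism of $K$-vector spaces $$HQ^1(A)\;\cong\; HH^1(A)\oplus \mathrm{Hom}_K\bigl(A/[A,A],\,Z(A)\bigr),$$ where $HH^1(A)=HH^1(A,A)$ is the first Hochschild cohomology of $A$ with coefficients in $A$ (the cohomology of the Hochschild complex $\mathrm{Hom}_K(A^{\otimes\bullet},A)$), $[A,A]$ is the $K$-linear span of all commutators $ab-ba$, and $Z(A)$ is the center of the associative algebra $A$. -/

import Mathlib

universe u v w

open scoped TensorProduct
open CategoryTheory

/-! ## Smash products `R # U(L)` -/

section SmashProduct

attribute [local instance 100] LieRing.ofAssociativeRing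

/-- An action of a Lie algebra `L` on an associative algebra `R` by derivations. -/
structure DerivationAction (K : Type u) (L : Type v) (R : Type w) [Field K] [LieRing L]
    [LieAlgebra K L] [Ring R] [Algebra K R] where
  /-- the action `x ↦ (r ↦ x · r)`, a Lie algebra map into the endomorphisms of `R` -/
  act : L →ₗ⁅K⁆ Module.End K R
  /-- every element of `L` acts by a derivation -/
  leibniz : ∀ (x : L) (r s : R), act x (r * s) = act x r * s + r * act x s

variable {K : Type u} {L : Type v} {R : Type w} [Field K] [LieRing L] [LieAlgebra K L]
  [Ring R] [Algebra K R]

/-- The coproduct of the universal enveloping algebra: the algebra map `U(L) → U(L) ⊗ U(L)`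
with `x ↦ x ⊗ 1 + 1 ⊗ x` for `x ∈ L`. -/
noncomputable def UniversalEnvelopingAlgebra.coproduct (K : Type u) (L : Type v) [Field K]
    [LieRing L] [LieAlgebra K L] : UniversalEnvelopingAlgebra K L →ₐ[K]
      UniversalEnvelopingAlgebra K L ⊗[K] UniversalEnvelopingAlgebra K L :=
  UniversalEnvelopingAlgebra.lift K
    { toFun := fun x => UniversalEnvelopingAlgebra.ι K x ⊗ₜ[K] 1 +
        1 ⊗ₜ[K] UniversalEnvelopingAlgebra.ι K x
      map_add' := fun x y => by
        simp only [map_add, TensorProduct.add_tmul, TensorProduct.tmul_add]; abel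
      map_smul' := fun c x => by
        simp only [map_smul, TensorProduct.smul_tmul', TensorProduct.tmul_smul, smul_add,
          RingHom.id_apply]
      map_lie' := fun {x y} => by
        simp only [LieHom.map_lie, LieRing.of_associative_ring_bracket, mul_add, add_mul,
          Algebra.TensorProduct.tmul_mul_tmul, one_mul, mul_one, TensorProduct.sub_tmul,
          TensorProduct.tmul_sub]
        abel }

theorem UniversalEnvelopingAlgebra.coproduct_ι (x : L) :
    UniversalEnvelopingAlgebra.coproduct K L (UniversalEnvelopingAlgebra.ι K x) =
      UniversalEnvelopingAlgebra.ι K x ⊗ₜ[K] 1 + 1 ⊗ₜ[K] UniversalEnvelopingAlgebra.ι K x :=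
  UniversalEnvelopingAlgebra.lift_ι_apply K _ x

namespace DerivationAction

/-- The induced action of `U(L)` on `R`. -/
noncomputable def uact (D : DerivationAction K L R) :
    UniversalEnvelopingAlgebra K L →ₐ[K] Module.End K R :=
  UniversalEnvelopingAlgebra.lift K D.act

/-- The action of `U(L)` on the tensor product of the `U(L)`-modules `R` and `U(L)`:
`h · (s ⊗ k) = ∑ (h₁ · s) ⊗ h₂ k`, where `Δ h = ∑ h₁ ⊗ h₂`. -/
noncomputable def diag (D : DerivationAction K L R) :
    UniversalEnvelopingAlgebra K L →ₐ[K]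
      Module.End K (R ⊗[K] UniversalEnvelopingAlgebra K L) :=
  ((Module.endTensorEndAlgHom (R := K) (S := K) (A := K) (M := R)
      (N := UniversalEnvelopingAlgebra K L)).comp
    (Algebra.TensorProduct.map D.uact
      (Algebra.lmul K (UniversalEnvelopingAlgebra K L)))).comp
    (UniversalEnvelopingAlgebra.coproduct K L)

theorem diag_ι (D : DerivationAction K L R) (x : L) (s : R)
    (k : UniversalEnvelopingAlgebra K L) :
    D.diag (UniversalEnvelopingAlgebra.ι K x) (s ⊗ₜ k) =
      D.act x s ⊗ₜ k + s ⊗ₜ (UniversalEnvelopingAlgebra.ι K x * k) := by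
  simp only [diag, AlgHom.comp_apply, UniversalEnvelopingAlgebra.coproduct_ι, map_add,
    Algebra.TensorProduct.map_tmul, map_one, Module.endTensorEndAlgHom_apply]
  simp [uact]

/-- Left multiplication by `r` on the first factor of `R ⊗ U(L)`. -/
noncomputable def left (K : Type u) (L : Type v) (R : Type w) [Field K] [LieRing L]
    [LieAlgebra K L] [Ring R] [Algebra K R] :
    R →ₐ[K] Module.End K (R ⊗[K] UniversalEnvelopingAlgebra K L) :=
  (Module.endTensorEndAlgHom (R := K) (S := K) (A := K) (M := R)
      (N := UniversalEnvelopingAlgebra K L)).comp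
    (Algebra.TensorProduct.includeLeft.comp (Algebra.lmul K R))

theorem left_tmul (r s : R) (k : UniversalEnvelopingAlgebra K L) :
    left K L R r (s ⊗ₜ k) = (r * s) ⊗ₜ k := by
  simp [left, Module.endTensorEndAlgHom_apply]

/-- The multiplication of the smash product:
`(r # h) (s # k) = ∑ r (h₁ · s) # h₂ k`. -/
noncomputable def smashMul (D : DerivationAction K L R) :
    R ⊗[K] UniversalEnvelopingAlgebra K L →ₗ[K]
      Module.End K (R ⊗[K] UniversalEnvelopingAlgebra K L) :=
  TensorProduct.lift
    ((LinearMap.mul K (Module.End K (R ⊗[K] UniversalEnvelopingAlgebra K L))).compl₁₂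
      (left K L R).toLinearMap D.diag.toLinearMap)

theorem smashMul_tmul (D : DerivationAction K L R) (r : R)
    (h : UniversalEnvelopingAlgebra K L) (y : R ⊗[K] UniversalEnvelopingAlgebra K L) :
    D.smashMul (r ⊗ₜ h) y = left K L R r (D.diag h y) := rfl

end DerivationAction

/-- An induction principle: `U(L)` is generated by `L` as an algebra. -/
theorem UniversalEnvelopingAlgebra.generator_induction
    {P : UniversalEnvelopingAlgebra K L → Prop} (scalar : ∀ c : K, P (algebraMap K _ c))
    (gen : ∀ x : L, P (UniversalEnvelopingAlgebra.ι K x))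
    (add : ∀ a b, P a → P b → P (a + b)) (mul : ∀ a b, P a → P b → P (a * b))
    (h : UniversalEnvelopingAlgebra K L) : P h := by
  let S : Subalgebra K (UniversalEnvelopingAlgebra K L) :=
    { carrier := {a | P a}
      mul_mem' := fun ha hb => mul _ _ ha hb
      add_mem' := fun ha hb => add _ _ ha hb
      algebraMap_mem' := scalar }
  let f : L →ₗ⁅K⁆ S :=
    { toFun := fun x => ⟨UniversalEnvelopingAlgebra.ι K x, gen x⟩
      map_add' := fun x y => Subtype.ext (map_add _ x y)
      map_smul' := fun c x => Subtype.ext (map_smul _ c x)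
      map_lie' := fun {x y} => Subtype.ext (by
        simp only [LieHom.map_lie, LieRing.of_associative_ring_bracket]; rfl) }
  have hid : S.val.comp (UniversalEnvelopingAlgebra.lift K f) = AlgHom.id K _ := by
    apply UniversalEnvelopingAlgebra.hom_ext
    ext x
    have : UniversalEnvelopingAlgebra.lift K f (UniversalEnvelopingAlgebra.ι K x) = f x :=
      UniversalEnvelopingAlgebra.lift_ι_apply K f x
    exact congrArg Subtype.val this
  have hval : ((UniversalEnvelopingAlgebra.lift K f h : S) : UniversalEnvelopingAlgebra K L) = h :=
    DFunLike.congr_fun hid h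
  rw [← hval]
  exact (UniversalEnvelopingAlgebra.lift K f h).2

namespace DerivationAction

theorem act_one (D : DerivationAction K L R) (x : L) : D.act x 1 = 0 := by
  have := D.leibniz x 1 1
  simpa using this

theorem diag_one_tmul (D : DerivationAction K L R) (h k : UniversalEnvelopingAlgebra K L) :
    D.diag h (1 ⊗ₜ k) = 1 ⊗ₜ (h * k) := by
  induction h using UniversalEnvelopingAlgebra.generator_induction generalizing k with
  | scalar c => simp [Algebra.algebraMap_eq_smul_one]
  | gen x => rw [diag_ι, act_one, TensorProduct.zero_tmul, zero_add]
  | add a b ha hb => simp [ha, hb, add_mul, TensorProduct.tmul_add]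
  | mul a b ha hb => simp [ha, hb, mul_assoc]

theorem smashMul_left (D : DerivationAction K L R) (r : R)
    (z : R ⊗[K] UniversalEnvelopingAlgebra K L) :
    D.smashMul (left K L R r z) = left K L R r * D.smashMul z := by
  induction z with
  | zero => simp
  | add a b ha hb => simp [ha, hb, mul_add]
  | tmul s k =>
    apply LinearMap.ext
    intro y
    rw [left_tmul, smashMul_tmul, map_mul, Module.End.mul_apply, Module.End.mul_apply,
      smashMul_tmul]

theorem smashMul_diag (D : DerivationAction K L R) (h : UniversalEnvelopingAlgebra K L)
    (z : R ⊗[K] UniversalEnvelopingAlgebra K L) :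
    D.smashMul (D.diag h z) = D.diag h * D.smashMul z := by
  induction h using UniversalEnvelopingAlgebra.generator_induction generalizing z with
  | scalar c => simp [Algebra.algebraMap_eq_smul_one]
  | add a b ha hb => simp [ha, hb, add_mul]
  | mul a b ha hb => simp [ha, hb, mul_assoc]
  | gen x =>
    have key : ∀ (s : R) (y : R ⊗[K] UniversalEnvelopingAlgebra K L),
        D.diag (UniversalEnvelopingAlgebra.ι K x) (left K L R s y) =
          left K L R (D.act x s) y +
            left K L R s (D.diag (UniversalEnvelopingAlgebra.ι K x) y) := by
      intro s y
      induction y with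
      | zero => simp
      | add a b ha hb => simp only [map_add, ha, hb]; abel
      | tmul t k =>
        simp only [left_tmul, diag_ι, D.leibniz, map_add, TensorProduct.add_tmul]
        abel
    induction z with
    | zero => simp
    | add a b ha hb => rw [map_add, map_add, ha, hb, map_add, mul_add]
    | tmul s k =>
      apply LinearMap.ext
      intro y
      rw [diag_ι, map_add, LinearMap.add_apply, smashMul_tmul, smashMul_tmul, map_mul,
        Module.End.mul_apply, Module.End.mul_apply, smashMul_tmul, key]

theorem smashMul_assoc (D : DerivationAction K L R)
    (x y : R ⊗[K] UniversalEnvelopingAlgebra K L) :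
    D.smashMul (D.smashMul x y) = D.smashMul x * D.smashMul y := by
  induction x with
  | zero => simp
  | add a b ha hb => simp [ha, hb, add_mul]
  | tmul r h =>
    rw [smashMul_tmul, smashMul_left, smashMul_diag]
    apply LinearMap.ext
    intro z
    simp [smashMul_tmul]

/-- The smash product `R # U(L)`, with underlying vector space `R ⊗ U(L)`. -/
def Smash (_D : DerivationAction K L R) : Type (max u v w) :=
  R ⊗[K] UniversalEnvelopingAlgebra K L

noncomputable instance (D : DerivationAction K L R) : AddCommGroup D.Smash :=
  inferInstanceAs (AddCommGroup (R ⊗[K] UniversalEnvelopingAlgebra K L))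

noncomputable instance (D : DerivationAction K L R) : Module K D.Smash :=
  inferInstanceAs (Module K (R ⊗[K] UniversalEnvelopingAlgebra K L))

/-- The element `r # h` of the smash product. -/
noncomputable def smash (D : DerivationAction K L R) (r : R)
    (h : UniversalEnvelopingAlgebra K L) : D.Smash := r ⊗ₜ[K] h

noncomputable instance (D : DerivationAction K L R) : Ring D.Smash :=
  { (inferInstance : AddCommGroup D.Smash) with
    one := D.smash 1 1
    mul := fun x y => D.smashMul x y
    left_distrib := fun x y z => map_add (D.smashMul x) y z
    right_distrib := fun x y z => LinearMap.congr_fun (map_add D.smashMul x y) z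
    zero_mul := fun x => LinearMap.congr_fun (map_zero D.smashMul) x
    mul_zero := fun x => map_zero (D.smashMul x)
    mul_assoc := fun x y z => LinearMap.congr_fun (D.smashMul_assoc x y) z
    one_mul := fun x => by
      change D.smashMul (1 ⊗ₜ 1) x = x
      have : D.smashMul (1 ⊗ₜ 1) = 1 := by
        apply LinearMap.ext
        intro y
        simp [smashMul_tmul]
      rw [this]; rfl
    mul_one := fun x => by
      change D.smashMul x (1 ⊗ₜ 1) = x
      induction x using TensorProduct.induction_on with
      | zero => simp
      | add a b ha hb => rw [map_add, LinearMap.add_apply, ha, hb]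
      | tmul r h => simp [smashMul_tmul, diag_one_tmul, left_tmul] }

noncomputable instance (D : DerivationAction K L R) : Algebra K D.Smash :=
  Algebra.ofModule
    (fun c x y => LinearMap.congr_fun (map_smul D.smashMul c x) y)
    (fun c x y => map_smul (D.smashMul x) c y)

theorem smash_mul_smash (D : DerivationAction K L R) (r s : R)
    (h k : UniversalEnvelopingAlgebra K L) :
    D.smash r h * D.smash s k = left K L R r (D.diag h (s ⊗ₜ k)) := rfl

/-- Let `σ : R → End V` and `τ : L → End V` be an algebra map and a Lie algebra map with
`τ x (σ r v) = σ (x · r) v + σ r (τ x v)`. Then `R # U(L)` acts on `V` by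
`(r # h) v = r (h v)`. -/
noncomputable def smashLift (D : DerivationAction K L R) {V : Type*} [AddCommGroup V]
    [Module K V] (σ : R →ₐ[K] Module.End K V) (τ : L →ₗ⁅K⁆ Module.End K V)
    (compat : ∀ (x : L) (r : R), τ x * σ r = σ (D.act x r) + σ r * τ x) :
    D.Smash →ₐ[K] Module.End K V :=
  let F : R ⊗[K] UniversalEnvelopingAlgebra K L →ₗ[K] Module.End K V :=
    TensorProduct.lift ((LinearMap.mul K (Module.End K V)).compl₁₂ σ.toLinearMap
      (UniversalEnvelopingAlgebra.lift K τ).toLinearMap)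
  have hF : ∀ r h, F (r ⊗ₜ h) = σ r * UniversalEnvelopingAlgebra.lift K τ h := fun _ _ => rfl
  have hleft : ∀ r z, F (left K L R r z) = σ r * F z := by
    intro r z
    induction z with
    | zero => simp
    | add a b ha hb => simp only [map_add, ha, hb, mul_add]
    | tmul s k => rw [left_tmul, hF, hF, map_mul, mul_assoc]
  have hdiag : ∀ h z, F (D.diag h z) = UniversalEnvelopingAlgebra.lift K τ h * F z := by
    intro h
    induction h using UniversalEnvelopingAlgebra.generator_induction with
    | scalar c => simp [Algebra.algebraMap_eq_smul_one]
    | add a b ha hb => intro z; simp [ha, hb, add_mul]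
    | mul a b ha hb => intro z; simp [ha, hb, mul_assoc]
    | gen x =>
      intro z
      induction z with
      | zero => simp
      | add a b ha hb => simp only [map_add, ha, hb, mul_add]
      | tmul s k =>
        rw [diag_ι, map_add, hF, hF, hF, map_mul, UniversalEnvelopingAlgebra.lift_ι_apply,
          ← mul_assoc, ← mul_assoc, compat, add_mul]
  have hmul : ∀ x y, F (D.smashMul x y) = F x * F y := by
    intro x y
    induction x with
    | zero => simp
    | add a b ha hb => rw [map_add, LinearMap.add_apply, map_add, map_add, ha, hb, add_mul]
    | tmul r h => rw [smashMul_tmul, hleft, hdiag, hF, mul_assoc]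
  AlgHom.ofLinearMap (show D.Smash →ₗ[K] Module.End K V from F)
    (by
      change F (1 ⊗ₜ 1) = 1
      rw [hF, map_one, map_one, one_mul])
    hmul

theorem smashLift_smash (D : DerivationAction K L R) {V : Type*} [AddCommGroup V]
    [Module K V] (σ : R →ₐ[K] Module.End K V) (τ : L →ₗ⁅K⁆ Module.End K V)
    (compat : ∀ (x : L) (r : R), τ x * σ r = σ (D.act x r) + σ r * τ x) (r : R)
    (h : UniversalEnvelopingAlgebra K L) :
    D.smashLift σ τ compat (D.smash r h) = σ r * UniversalEnvelopingAlgebra.lift K τ h := rfl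

end DerivationAction

/-! ## Poisson algebras and the quasi-Poisson enveloping algebra -/

/-- A (not necessarily commutative) Poisson structure on the associative `K`-algebra `A`:
a Lie bracket on `A` satisfying the Leibniz rule `{a, bc} = {a, b}c + b{a, c}`. -/
structure PoissonStructure (K : Type u) (A : Type v) [Field K] [Ring A] [Algebra K A] where
  /-- the bracket `{a, b}` -/
  bracket : A →ₗ[K] A →ₗ[K] A
  bracket_self : ∀ a, bracket a a = 0
  jacobi : ∀ a b c,
    bracket a (bracket b c) = bracket (bracket a b) c + bracket b (bracket a c)
  leibniz : ∀ a b c, bracket a (b * c) = bracket a b * c + b * bracket a c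

namespace PoissonStructure

/-- The standard Poisson structure `{a, b} = λ(ab - ba)`. -/
def standard (K : Type u) (A : Type v) [Field K] [Ring A] [Algebra K A] (l : K) :
    PoissonStructure K A where
  bracket := l • (LinearMap.mul K A - (LinearMap.mul K A).flip)
  bracket_self a := by simp
  jacobi a b c := by
    simp only [LinearMap.smul_apply, LinearMap.sub_apply, LinearMap.flip_apply,
      LinearMap.mul_apply', smul_sub, map_smul, map_sub, mul_assoc]
    abel
  leibniz a b c := by
    simp only [LinearMap.smul_apply, LinearMap.sub_apply, LinearMap.flip_apply,
      LinearMap.mul_apply', mul_sub, sub_mul, smul_sub, mul_smul_comm,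
      smul_mul_assoc, mul_assoc]
    abel

variable {K : Type u} {A : Type v} [Field K] [Ring A] [Algebra K A]

/-- The vector space `A` regarded as a Lie algebra under the Poisson bracket. -/
def LieAlg (_P : PoissonStructure K A) : Type v := A

instance (P : PoissonStructure K A) : AddCommGroup P.LieAlg := inferInstanceAs (AddCommGroup A)

instance (P : PoissonStructure K A) : Module K P.LieAlg := inferInstanceAs (Module K A)

instance (P : PoissonStructure K A) : LieRing P.LieAlg where
  bracket a b := P.bracket a b
  add_lie a b c := LinearMap.congr_fun (map_add P.bracket a b) c
  lie_add a b c := map_add (P.bracket a) b c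
  lie_self a := P.bracket_self a
  leibniz_lie a b c := P.jacobi a b c

instance (P : PoissonStructure K A) : LieAlgebra K P.LieAlg where
  lie_smul c a b := map_smul (P.bracket a) c b

/-- The adjoint action `x ↦ {x, -}` of the Lie algebra `A` on the vector space `A`. -/
def ad (P : PoissonStructure K A) : P.LieAlg →ₗ⁅K⁆ Module.End K A where
  toFun x := P.bracket x
  map_add' x y := map_add P.bracket x y
  map_smul' c x := map_smul P.bracket c x
  map_lie' {x y} := by
    apply LinearMap.ext
    intro z
    rw [LieRing.of_associative_ring_bracket]
    exact eq_sub_of_add_eq (P.jacobi x y z).symm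

/-- The endomorphism `f` of `A` regarded as an endomorphism of the opposite algebra. -/
def opEnd (f : Module.End K A) : Module.End K Aᵐᵒᵖ :=
  (MulOpposite.opLinearEquiv K).toLinearMap ∘ₗ f ∘ₗ (MulOpposite.opLinearEquiv K).symm.toLinearMap

/-- The action of the Lie algebra `A` on the enveloping algebra `Aᵉ = A ⊗ Aᵒᵖ`:
`x · (a ⊗ b') = {x, a} ⊗ b' + a ⊗ {x, b}'`. -/
noncomputable def envAction (P : PoissonStructure K A) :
    DerivationAction K P.LieAlg (A ⊗[K] Aᵐᵒᵖ) where
  act :=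
    { toFun := fun x => TensorProduct.map (P.ad x) LinearMap.id +
        TensorProduct.map LinearMap.id (opEnd (P.ad x))
      map_add' := fun x y => by
        apply TensorProduct.ext'
        intro a b
        simp [opEnd, TensorProduct.add_tmul, TensorProduct.tmul_add]
        abel
      map_smul' := fun c x => by
        apply TensorProduct.ext'
        intro a b
        simp [opEnd, TensorProduct.smul_tmul']
      map_lie' := fun {x y} => by
        apply TensorProduct.ext'
        intro a b
        simp [opEnd, LieRing.of_associative_ring_bracket, TensorProduct.sub_tmul,
          TensorProduct.tmul_sub]
        abel }
  leibniz x r s := by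
    induction r with
    | zero => simp
    | add r r' h h' => simp only [add_mul, map_add, h, h']; abel
    | tmul a b =>
      induction s with
      | zero => simp
      | add s s' h h' => simp only [mul_add, map_add, h, h']; abel
      | tmul c d =>
        have hl : ∀ u v : A, P.ad x (u * v) = P.ad x u * v + u * P.ad x v := P.leibniz x
        simp [opEnd, hl, TensorProduct.add_tmul, TensorProduct.tmul_add, add_mul, mul_add]
        abel

/-- The quasi-Poisson enveloping algebra `Q(A) = Aᵉ # U(A)`. -/
abbrev Envelope (P : PoissonStructure K A) := P.envAction.Smash

/-- The action of `Q(A)` on `A`: `(a ⊗ b' # h) m = a (h · m) b`, where `x · m = {x, m}` for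
`x ∈ A ⊆ U(A)`. -/
noncomputable def regularAction (P : PoissonStructure K A) : P.Envelope →ₐ[K] Module.End K A :=
  P.envAction.smashLift (AlgHom.mulLeftRight K A) P.ad (by
    intro x r
    have hl : ∀ u v : A, P.ad x (u * v) = P.ad x u * v + u * P.ad x v := P.leibniz x
    induction r with
    | zero => simp
    | add r r' h h' => simp only [map_add, mul_add, add_mul, h, h']; abel
    | tmul a b =>
      apply LinearMap.ext
      intro m
      simp [envAction, opEnd, hl, add_mul]
      abel)

/-- The regular quasi-Poisson module `A`, as a left `Q(A)`-module. -/
noncomputable instance regularModule (P : PoissonStructure K A) : Module P.Envelope A :=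
  Module.compHom A P.regularAction.toRingHom

theorem regular_smul_def (P : PoissonStructure K A) (q : P.Envelope) (m : A) :
    q • m = P.regularAction q m := rfl

end PoissonStructure

end SmashProduct

/-! ## Quasi-Poisson cohomology -/

/-- The quasi-Poisson cohomology `HQⁿ(A, M) = Extⁿ_{Q(A)}(A, M)`, for a `Q(A)`-module (that is,
a quasi-Poisson module) `M`. -/
noncomputable abbrev PoissonStructure.HQ {K A : Type u} [Field K] [Ring A] [Algebra K A]
    (P : PoissonStructure K A) (n : ℕ) (M : ModuleCat.{u} P.Envelope) : Type u :=
  Abelian.Ext (ModuleCat.of P.Envelope A) M n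

/-! ## Hochschild cohomology -/

namespace Hochschild

variable {K : Type u} {A : Type v} [Field K] [Ring A] [Algebra K A]

/-- The Hochschild cochains `Hom(A^{⊗ n}, A)`. -/
abbrev Cochain (K : Type u) (A : Type v) [Field K] [Ring A] [Algebra K A] (n : ℕ) : Type _ :=
  MultilinearMap K (fun _ : Fin n => A) A

instance (K : Type u) (A : Type v) [Field K] [Ring A] [Algebra K A] (n : ℕ) :
    AddCommGroup (Cochain K A n) :=
  inferInstanceAs (AddCommGroup (MultilinearMap K (fun _ : Fin n => A) A))

/-- Updating one entry of `(a₀, …, aₙ)` changes `(a₀, …, aⱼaⱼ₊₁, …, aₙ)` in one entry, and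
linearly so. -/
theorem contractNth_update {n : ℕ} (j : Fin n) (a : Fin (n + 1) → A) (i : Fin (n + 1)) :
    ∃ (i' : Fin n) (φ : A →ₗ[K] A), ∀ x : A,
      Fin.contractNth j.castSucc (· * ·) (Function.update a i x) =
        Function.update (Fin.contractNth j.castSucc (· * ·) a) i' (φ x) := by
  rcases lt_trichotomy (i : ℕ) j with h | h | h
  · refine ⟨⟨i, by omega⟩, LinearMap.id, fun x => funext fun k => ?_⟩
    simp only [Fin.contractNth, Function.update_apply, Fin.ext_iff, Fin.val_castSucc,
      Fin.val_succ, LinearMap.id_apply]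
    split_ifs <;> first | rfl | omega
  · refine ⟨j, LinearMap.mulRight K (a j.succ), fun x => funext fun k => ?_⟩
    simp only [Fin.contractNth, Function.update_apply, Fin.ext_iff, Fin.val_castSucc,
      Fin.val_succ, LinearMap.mulRight_apply]
    split_ifs with h1 h2 h3 <;> first | rfl | omega | skip
    have : k = j := Fin.ext (by assumption)
    rw [this]
  · rcases eq_or_lt_of_le (Nat.succ_le_of_lt h) with h' | h'
    · refine ⟨j, LinearMap.mulLeft K (a j.castSucc), fun x => funext fun k => ?_⟩
      simp only [Fin.contractNth, Function.update_apply, Fin.ext_iff, Fin.val_castSucc,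
        Fin.val_succ, LinearMap.mulLeft_apply]
      split_ifs with h1 h2 h3 <;> first | rfl | omega | skip
      have : k = j := Fin.ext (by assumption)
      rw [this]
    · refine ⟨⟨i - 1, by omega⟩, LinearMap.id, fun x => funext fun k => ?_⟩
      simp only [Fin.contractNth, Function.update_apply, Fin.ext_iff, Fin.val_castSucc,
        Fin.val_succ, LinearMap.id_apply]
      split_ifs <;> first | rfl | omega

/-- The cochain `(a₀, …, aₙ) ↦ f(a₀, …, aⱼaⱼ₊₁, …, aₙ)`. -/
def contract {n : ℕ} (j : Fin n) : Cochain K A n →ₗ[K] Cochain K A (n + 1) where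
  toFun f :=
    { toFun := fun a => f (Fin.contractNth j.castSucc (· * ·) a)
      map_update_add' := fun {dec} a i x y => by
        rw [Subsingleton.elim dec (instDecidableEqFin _)]
        obtain ⟨i', φ, h⟩ := contractNth_update (K := K) j a i
        rw [h, h, h, map_add, f.map_update_add]
      map_update_smul' := fun {dec} a i c x => by
        rw [Subsingleton.elim dec (instDecidableEqFin _)]
        obtain ⟨i', φ, h⟩ := contractNth_update (K := K) j a i
        rw [h, h, map_smul, f.map_update_smul] }
  map_add' _ _ := rfl
  map_smul' _ _ := rfl

/-- The cochain `(a₀, …, aₙ) ↦ a₀ f(a₁, …, aₙ)`. -/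
def first {n : ℕ} : Cochain K A n →ₗ[K] Cochain K A (n + 1) where
  toFun f := LinearMap.uncurryLeft
    { toFun := fun x => (LinearMap.mulLeft K x).compMultilinearMap f
      map_add' := fun x y => by ext a; simp [add_mul]
      map_smul' := fun c x => by ext a; simp }
  map_add' f g := by ext a; simp
  map_smul' c f := by ext a; simp

/-- The cochain `(a₀, …, aₙ) ↦ f(a₀, …, aₙ₋₁) aₙ`. -/
def last {n : ℕ} : Cochain K A n →ₗ[K] Cochain K A (n + 1) where
  toFun f := MultilinearMap.uncurryRight
    ((LinearMap.mul K A).compMultilinearMap f)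
  map_add' f g := by ext a; simp
  map_smul' c f := by ext a; simp

/-- The Hochschild differential `δⁿ : Hom(A^{⊗ n}, A) → Hom(A^{⊗ (n+1)}, A)`. -/
def differential (K : Type u) (A : Type v) [Field K] [Ring A] [Algebra K A] (n : ℕ) :
    Cochain K A n →ₗ[K] Cochain K A (n + 1) :=
  first + ∑ j : Fin n, (-1 : K) ^ ((j : ℕ) + 1) • contract j + (-1 : K) ^ (n + 1) • last

theorem differential_apply (n : ℕ) (f : Cochain K A n) (a : Fin (n + 1) → A) :
    differential K A n f a = a 0 * f (fun i => a i.succ) +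
      ∑ j : Fin n, (-1 : K) ^ ((j : ℕ) + 1) •
        f (Fin.contractNth j.castSucc (· * ·) a) +
      (-1 : K) ^ (n + 1) • (f (fun i => a i.castSucc) * a (Fin.last n)) := by
  simp only [differential, LinearMap.add_apply, LinearMap.sum_apply, LinearMap.smul_apply,
    add_apply, sum_apply, smul_apply]
  rfl

/-- The coboundaries: the image of the incoming differential (zero in degree `0`). -/
def coboundaries (K : Type u) (A : Type v) [Field K] [Ring A] [Algebra K A] :
    (n : ℕ) → Submodule K (Cochain K A n)
  | 0 => ⊥
  | n + 1 => LinearMap.range (differential K A n)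

/-- The Hochschild cohomology `HHⁿ(A) = HHⁿ(A, A) = Ker δⁿ / Im δⁿ⁻¹`. -/
abbrev HH (K : Type u) (A : Type v) [Field K] [Ring A] [Algebra K A] (n : ℕ) : Type _ :=
  LinearMap.ker (differential K A n) ⧸
    (coboundaries K A n).submoduleOf (LinearMap.ker (differential K A n))

end Hochschild

/-- The subspace `[A, A]` of `A` spanned by the commutators `ab - ba`. -/
def commutatorSubspace (K : Type u) (A : Type v) [Field K] [Ring A] [Algebra K A] :
    Submodule K A :=
  Submodule.span K {x | ∃ a b : A, x = a * b - b * a}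

/-! The module `A` is cyclic over Q = Q(A), generated by 1. If I is the annihilator of 1, the
sequence 0 → I → Q → A → 0 has a projective middle term, so Ext¹(A, A) is Hom_Q(I, A) modulo the
maps q ↦ q m (`exists_ext_one_of_cyclic`).

As a left ideal, I is generated by a ⊗ 1' - 1 ⊗ a' and 1 # x (`annOne_le`). A map φ on I is
therefore a pair (D, f) of its values on the two families. The relations of Q make D a derivation
and f a Lie 1-cocycle, linked by {x, D a} = D{x, a} + [a, f x]. Conversely, each such pair twists A
⊕ A into a self-extension of `A`, from which φ is recovered (`exists_annOne_hom`).

For {a, b} = l[a, b], the link says that f - lD takes values in the center. The cocycle identity,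
after division by l, says that f - lD kills commutators. Thus φ amounts to a derivation D and an
arbitrary linear map A/[A, A] → Z(A). The maps q ↦ q m are those with D inner and f = lD, and the
quotient is HH¹ ⊕ Hom(A/[A, A], Z(A)) (`partsMap_surjective`, `partsMap_eq_zero_iff`). -/

/-! ### First Ext of a cyclic module. -/

section CyclicExt

open Abelian
open scoped ModuleCat

variable {k Q M : Type u} [Field k] [Ring Q] [Algebra k Q] [AddCommGroup M] [Module Q M]

/-- For a cyclic module `M = Q m₀` with annihilator `I`, the connecting map
`Hom_Q(I, N) → Ext¹_Q(M, N)` is surjective, and its kernel consists of the maps `q ↦ q n`. -/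
theorem exists_ext_one_of_cyclic (m₀ : M)
    (hm₀ : Function.Surjective (LinearMap.toSpanSingleton Q M m₀)) (N : ModuleCat.{u} Q) :
    ∃ δ : (ModuleCat.of Q (LinearMap.ker (LinearMap.toSpanSingleton Q M m₀)) ⟶ N) →ₗ[k]
        Ext (ModuleCat.of Q M) N 1,
      Function.Surjective δ ∧ ∀ φ, δ φ = 0 ↔ ∃ n : N, ∀ q, φ.hom q = (q : Q) • n := by
  let S : ShortComplex (ModuleCat.{u} Q) :=
    ShortComplex.mk (ModuleCat.ofHom (LinearMap.ker (LinearMap.toSpanSingleton Q M m₀)).subtype)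
      (ModuleCat.ofHom (LinearMap.toSpanSingleton Q M m₀)) (by
        ext x
        exact x.2)
  have hS : S.ShortExact :=
    { exact := by
        rw [ShortComplex.moduleCat_exact_iff]
        intro x hx
        exact ⟨⟨x, hx⟩, rfl⟩
      mono_f := (ModuleCat.mono_iff_injective _).2 Subtype.val_injective
      epi_g := (ModuleCat.epi_iff_surjective _).2 hm₀ }
  have : Projective S.X₂ := inferInstanceAs (Projective (ModuleCat.of Q Q))
  refine ⟨(Ext.precompOfLinear hS.extClass k N (add_zero 1)).comp
    (Ext.linearEquiv₀ (R := k)).symm.toLinearMap, fun x => ?_, fun φ => ?_⟩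
  -- Surjectivity: the next term of the long exact sequence is Ext¹(Q, N), which vanishes because Q
  -- is projective.
  · obtain ⟨y, hy⟩ := Ext.contravariant_sequence_exact₃ hS N x (Ext.eq_zero_of_projective _)
      (add_zero 1)
    refine ⟨Ext.linearEquiv₀ (R := k) y, ?_⟩
    simpa using hy
  · have hδ : ((Ext.precompOfLinear hS.extClass k N (add_zero 1)).comp
        (Ext.linearEquiv₀ (R := k)).symm.toLinearMap) φ =
        hS.extClass.comp (Ext.mk₀ φ) (add_zero 1) := by
      simp
    rw [hδ]
    constructor
    -- A vanishing class means that φ extends to some ψ : Q → N, and ψ is determined by n = ψ(1).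
    · intro h
      obtain ⟨y, hy⟩ := Ext.contravariant_sequence_exact₁ hS N (Ext.mk₀ φ) (add_zero 1) h
      obtain ⟨ψ, rfl⟩ := (Ext.addEquiv₀ (X := S.X₂) (Y := N)).symm.surjective y
      rw [Ext.addEquiv₀_symm_apply, Ext.mk₀_comp_mk₀] at hy
      have hφ : S.f ≫ ψ = φ := (Ext.mk₀_bijective _ _).1 hy
      refine ⟨ψ.hom (1 : Q), fun q => ?_⟩
      rw [← hφ]
      change ψ.hom (q : Q) = (q : Q) • ψ.hom (1 : Q)
      rw [← map_smul, smul_eq_mul, mul_one]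
    · rintro ⟨n, hn⟩
      let ψ : S.X₂ ⟶ N := ModuleCat.ofHom (LinearMap.toSpanSingleton Q N n)
      have hφ : φ = S.f ≫ ψ := by
        ext q
        exact hn q
      rw [hφ, ← Ext.mk₀_comp_mk₀, ← Ext.comp_assoc_of_second_deg_zero,
        hS.extClass_comp, Ext.zero_comp]

end CyclicExt

/-! ### Generators and relations of Q(A), and the annihilator of 1. -/

section EnvelopeGenerators

attribute [local instance 100] LieRing.ofAssociativeRing

namespace DerivationAction

variable {K : Type u} {L : Type v} {R : Type w} [Field K] [LieRing L] [LieAlgebra K L]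
  [Ring R] [Algebra K R] (D : DerivationAction K L R)

theorem smash_add (r : R) (h k : UniversalEnvelopingAlgebra K L) :
    D.smash r (h + k) = D.smash r h + D.smash r k := TensorProduct.tmul_add r h k

theorem add_smash (r s : R) (h : UniversalEnvelopingAlgebra K L) :
    D.smash (r + s) h = D.smash r h + D.smash s h := TensorProduct.add_tmul r s h

theorem smash_one_mul_smash (r s : R) (k : UniversalEnvelopingAlgebra K L) :
    D.smash r 1 * D.smash s k = D.smash (r * s) k := by
  rw [smash_mul_smash, map_one, Module.End.one_apply, left_tmul]; rfl

theorem smash_mul_one_smash (r : R) (h k : UniversalEnvelopingAlgebra K L) :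
    D.smash r h * D.smash 1 k = D.smash r (h * k) := by
  rw [smash_mul_smash, diag_one_tmul, left_tmul, mul_one]; rfl

theorem one_smash_ι_mul_smash (x : L) (s : R) (k : UniversalEnvelopingAlgebra K L) :
    D.smash 1 (UniversalEnvelopingAlgebra.ι K x) * D.smash s k =
      D.smash (D.act x s) k + D.smash s (UniversalEnvelopingAlgebra.ι K x * k) := by
  rw [smash_mul_smash, map_one, Module.End.one_apply, diag_ι]; rfl

/-- `R # U(L)` is generated by `R` and `L`. -/
theorem smash_induction {p : D.Smash → Prop} (coeff : ∀ r, p (D.smash r 1))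
    (gen : ∀ x : L, p (D.smash 1 (UniversalEnvelopingAlgebra.ι K x)))
    (add : ∀ a b, p a → p b → p (a + b)) (mul : ∀ a b, p a → p b → p (a * b))
    (q : D.Smash) : p q := by
  have hU : ∀ h : UniversalEnvelopingAlgebra K L, p (D.smash 1 h) := by
    intro h
    induction h using UniversalEnvelopingAlgebra.generator_induction with
    | scalar c =>
      have : D.smash 1 (algebraMap K _ c) = D.smash (algebraMap K R c) 1 := by
        rw [Algebra.algebraMap_eq_smul_one, Algebra.algebraMap_eq_smul_one]
        exact (TensorProduct.smul_tmul c (1 : R) (1 : UniversalEnvelopingAlgebra K L)).symm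
      rw [this]
      exact coeff _
    | gen x => exact gen x
    | add a b ha hb => rw [smash_add]; exact add _ _ ha hb
    | mul a b ha hb => rw [← smash_mul_one_smash]; exact mul _ _ ha hb
  refine TensorProduct.induction_on (motive := p) q ?_ ?_ add
  · have : (0 : D.Smash) = D.smash 0 1 := (TensorProduct.zero_tmul _ _).symm
    exact this ▸ coeff 0
  · intro r h
    -- The coefficient r splits off on the left without involving the coproduct of h.
    have : D.smash r h = D.smash r 1 * D.smash 1 h := by
      rw [smash_one_mul_smash, mul_one]
    change p (D.smash r h)
    rw [this]
    exact mul _ _ (coeff r) (hU h)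

end DerivationAction

namespace PoissonStructure

variable {K : Type u} {A : Type v} [Field K] [Ring A] [Algebra K A] (P : PoissonStructure K A)

/-- The element `a ⊗ 1' # 1` of `Q(A)`. -/
noncomputable def leftGen : A →ₗ[K] P.Envelope where
  toFun a := P.envAction.smash (a ⊗ₜ 1) 1
  map_add' a b := by rw [TensorProduct.add_tmul, DerivationAction.add_smash]
  map_smul' c a := rfl

/-- The element `1 ⊗ b' # 1` of `Q(A)`. -/
noncomputable def rightGen : A →ₗ[K] P.Envelope where
  toFun b := P.envAction.smash (1 ⊗ₜ MulOpposite.op b) 1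
  map_add' a b := by
    rw [MulOpposite.op_add, TensorProduct.tmul_add, DerivationAction.add_smash]
  map_smul' c a := by
    rw [MulOpposite.op_smul, TensorProduct.tmul_smul]; rfl

/-- The element `1 # x` of `Q(A)`. -/
noncomputable def lieGen : A →ₗ[K] P.Envelope where
  toFun x := P.envAction.smash 1 (UniversalEnvelopingAlgebra.ι K (show P.LieAlg from x))
  map_add' x y := by
    rw [← DerivationAction.smash_add]
    exact congrArg _ (map_add (UniversalEnvelopingAlgebra.ι K)
      (show P.LieAlg from x) (show P.LieAlg from y))
  map_smul' c x :=
    (congrArg (P.envAction.smash 1) (map_smul (UniversalEnvelopingAlgebra.ι K) c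
      (show P.LieAlg from x))).trans (TensorProduct.tmul_smul c _ _)

theorem leftGen_apply (a : A) : P.leftGen a = P.envAction.smash (a ⊗ₜ 1) 1 := rfl

theorem rightGen_apply (b : A) :
    P.rightGen b = P.envAction.smash (1 ⊗ₜ MulOpposite.op b) 1 := rfl

theorem lieGen_apply (x : A) :
    P.lieGen x =
      P.envAction.smash 1 (UniversalEnvelopingAlgebra.ι K (show P.LieAlg from x)) := rfl

theorem leftGen_one : P.leftGen 1 = 1 := rfl

theorem leftGen_mul (a b : A) : P.leftGen (a * b) = P.leftGen a * P.leftGen b := by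
  simp [leftGen_apply, DerivationAction.smash_one_mul_smash]

theorem rightGen_mul (a b : A) : P.rightGen (a * b) = P.rightGen b * P.rightGen a := by
  simp [rightGen_apply, DerivationAction.smash_one_mul_smash]

theorem leftGen_mul_rightGen (a b : A) :
    P.leftGen a * P.rightGen b = P.rightGen b * P.leftGen a := by
  simp [leftGen_apply, rightGen_apply, DerivationAction.smash_one_mul_smash]

theorem smash_eq_leftGen_mul_rightGen (a b : A) :
    P.envAction.smash (a ⊗ₜ MulOpposite.op b) 1 = P.leftGen a * P.rightGen b := by
  simp [leftGen_apply, rightGen_apply, DerivationAction.smash_one_mul_smash]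

theorem envAction_act_tmul (x a b : A) :
    P.envAction.act (show P.LieAlg from x) (a ⊗ₜ MulOpposite.op b) =
      P.bracket x a ⊗ₜ MulOpposite.op b + a ⊗ₜ MulOpposite.op (P.bracket x b) := rfl

theorem bracket_one (x : A) : P.bracket x 1 = 0 := by
  simpa using P.leibniz x 1 1

/-- Since x is primitive, moving it past a coefficient costs only the derivation term. Its component
in the opposite factor is {x, 1}' = 0. -/
theorem lieGen_mul_leftGen (x a : A) :
    P.lieGen x * P.leftGen a = P.leftGen (P.bracket x a) + P.leftGen a * P.lieGen x := by
  rw [lieGen_apply, leftGen_apply, leftGen_apply, DerivationAction.one_smash_ι_mul_smash,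
    DerivationAction.smash_mul_one_smash, mul_one, one_mul, ← MulOpposite.op_one,
    envAction_act_tmul, bracket_one, MulOpposite.op_zero, TensorProduct.tmul_zero, add_zero]

theorem lieGen_mul_rightGen (x b : A) :
    P.lieGen x * P.rightGen b = P.rightGen (P.bracket x b) + P.rightGen b * P.lieGen x := by
  rw [lieGen_apply, rightGen_apply, rightGen_apply, DerivationAction.one_smash_ι_mul_smash,
    DerivationAction.smash_mul_one_smash, mul_one, one_mul,
    envAction_act_tmul, bracket_one, TensorProduct.zero_tmul, zero_add]

theorem lieGen_bracket (x y : A) :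
    P.lieGen (P.bracket x y) = P.lieGen x * P.lieGen y - P.lieGen y * P.lieGen x := by
  rw [eq_sub_iff_add_eq, lieGen_apply, lieGen_apply, lieGen_apply,
    DerivationAction.smash_mul_one_smash, DerivationAction.smash_mul_one_smash,
    ← DerivationAction.smash_add]
  refine congrArg _ (eq_sub_iff_add_eq.1 ?_)
  exact LieHom.map_lie (UniversalEnvelopingAlgebra.ι K) (show P.LieAlg from x)
    (show P.LieAlg from y)

theorem leftGen_smul (a m : A) : P.leftGen a • m = a * m := by
  rw [regular_smul_def, leftGen_apply, regularAction, DerivationAction.smashLift_smash]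
  simp

theorem rightGen_smul (b m : A) : P.rightGen b • m = m * b := by
  rw [regular_smul_def, rightGen_apply, regularAction, DerivationAction.smashLift_smash]
  simp

theorem lieGen_smul (x m : A) : P.lieGen x • m = P.bracket x m := by
  rw [regular_smul_def, lieGen_apply, regularAction, DerivationAction.smashLift_smash,
    UniversalEnvelopingAlgebra.lift_ι_apply, map_one, one_mul]
  rfl

/-- `Q(A)` is generated by the elements `a ⊗ 1' # 1`, `1 ⊗ b' # 1` and `1 # x`. -/
theorem envelope_induction {p : P.Envelope → Prop} (left : ∀ a, p (P.leftGen a))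
    (right : ∀ b, p (P.rightGen b)) (lie : ∀ x, p (P.lieGen x))
    (add : ∀ a b, p a → p b → p (a + b)) (mul : ∀ a b, p a → p b → p (a * b))
    (q : P.Envelope) : p q := by
  refine P.envAction.smash_induction (fun r => ?_) lie add mul q
  induction r with
  | zero =>
    have h := left 0
    rwa [leftGen_apply, TensorProduct.zero_tmul] at h
  | add r s hr hs => rw [DerivationAction.add_smash]; exact add _ _ hr hs
  | tmul a b =>
    exact (P.smash_eq_leftGen_mul_rightGen a b.unop) ▸ mul _ _ (left a) (right b.unop)

/-- The left ideal of `Q(A)` that annihilates `1 ∈ A`. -/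
noncomputable abbrev annOne : Submodule P.Envelope P.Envelope :=
  LinearMap.ker (LinearMap.toSpanSingleton P.Envelope A 1)

theorem mem_annOne {q : P.Envelope} : q ∈ P.annOne ↔ q • (1 : A) = 0 := Iff.rfl

theorem leftGen_sub_rightGen_mem (a : A) : P.leftGen a - P.rightGen a ∈ P.annOne := by
  rw [mem_annOne, sub_smul, leftGen_smul, rightGen_smul, mul_one, one_mul, sub_self]

theorem lieGen_mem (x : A) : P.lieGen x ∈ P.annOne := by
  rw [mem_annOne, lieGen_smul, bracket_one]

/-- The annihilator of `1` is generated by the elements `a ⊗ 1' - 1 ⊗ a'` and `1 # x`. -/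
theorem annOne_le {J : Submodule P.Envelope P.Envelope}
    (hJ : ∀ a, P.leftGen a - P.rightGen a ∈ J) (hJ' : ∀ x, P.lieGen x ∈ J) :
    P.annOne ≤ J := by
  -- Modulo J, every q(m ⊗ 1' # 1) reduces to (q m) ⊗ 1' # 1. Allowing all m makes the claim stable
  -- under products in q; the case m = 1 with q · 1 = 0 gives the result.
  have key : ∀ (q : P.Envelope) (m : A), q * P.leftGen m - P.leftGen (q • m) ∈ J := by
    intro q
    induction q using P.envelope_induction with
    | left a =>
      intro m
      rw [leftGen_smul, leftGen_mul, sub_self]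
      exact J.zero_mem
    | right b =>
      intro m
      rw [rightGen_smul, leftGen_mul, ← leftGen_mul_rightGen, ← mul_sub, ← neg_sub, mul_neg]
      exact J.neg_mem (J.smul_mem _ (hJ b))
    | lie x =>
      intro m
      rw [lieGen_smul, lieGen_mul_leftGen, add_sub_cancel_left]
      exact J.smul_mem _ (hJ' x)
    | add a b ha hb =>
      intro m
      rw [add_mul, add_smul, map_add, add_sub_add_comm]
      exact J.add_mem (ha m) (hb m)
    | mul a b ha hb =>
      intro m
      have h : a * b * P.leftGen m - P.leftGen ((a * b) • m) =
          a • (b * P.leftGen m - P.leftGen (b • m)) +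
            (a * P.leftGen (b • m) - P.leftGen (a • b • m)) := by
        rw [smul_eq_mul, mul_sub, mul_assoc, mul_smul]; abel
      rw [h]
      exact J.add_mem (J.smul_mem a (hb m)) (ha _)
  intro q hq
  have h := key q 1
  rwa [P.mem_annOne.1 hq, map_zero, sub_zero, leftGen_one, mul_one] at h

end PoissonStructure

end EnvelopeGenerators

/-! ### Linear maps on the annihilator of 1 as pairs (D, f). -/

section ExtensionModule

attribute [local instance 100] LieRing.ofAssociativeRing

namespace PoissonStructure

variable {K : Type u} {A : Type v} [Field K] [Ring A] [Algebra K A] (P : PoissonStructure K A)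

section Restriction

variable (φ : P.annOne →ₗ[P.Envelope] A)

/-- The value of `φ` on `a ⊗ 1' - 1 ⊗ a'`. -/
noncomputable def derivationPart (a : A) : A :=
  φ ⟨P.leftGen a - P.rightGen a, P.leftGen_sub_rightGen_mem a⟩

/-- The value of `φ` on `1 # x`. -/
noncomputable def liePart (x : A) : A := φ ⟨P.lieGen x, P.lieGen_mem x⟩

theorem derivationPart_add (a b : A) :
    P.derivationPart φ (a + b) = P.derivationPart φ a + P.derivationPart φ b := by
  simp only [derivationPart, ← map_add]
  refine congrArg φ (Subtype.ext ?_)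
  simp only [map_add, Submodule.coe_add]
  abel

theorem liePart_add (a b : A) :
    P.liePart φ (a + b) = P.liePart φ a + P.liePart φ b := by
  simp only [liePart, ← map_add]
  refine congrArg φ (Subtype.ext ?_)
  simp only [map_add, Submodule.coe_add]

/-- The scalar action through Q(A) agrees with the given one, so Q(A)-linearity of φ yields
K-linearity of its two parts. -/
theorem algebraMap_envelope_smul (c : K) (m : A) : algebraMap K P.Envelope c • m = c • m := by
  rw [regular_smul_def, AlgHom.commutes, Module.algebraMap_end_apply]

theorem derivationPart_smul (c : K) (a : A) :
    P.derivationPart φ (c • a) = c • P.derivationPart φ a := by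
  refine Eq.trans ?_ (P.algebraMap_envelope_smul c _)
  rw [derivationPart, derivationPart, ← φ.map_smul]
  refine congrArg φ (Subtype.ext ?_)
  change P.leftGen (c • a) - P.rightGen (c • a) =
    algebraMap K P.Envelope c * (P.leftGen a - P.rightGen a)
  rw [← Algebra.smul_def, map_smul, map_smul, smul_sub]

theorem liePart_smul (c : K) (a : A) :
    P.liePart φ (c • a) = c • P.liePart φ a := by
  refine Eq.trans ?_ (P.algebraMap_envelope_smul c _)
  rw [liePart, liePart, ← φ.map_smul]
  refine congrArg φ (Subtype.ext ?_)
  change P.lieGen (c • a) = algebraMap K P.Envelope c * P.lieGen a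
  rw [← Algebra.smul_def, map_smul]

/-- Apply φ to ab ⊗ 1' - 1 ⊗ (ab)' = (a ⊗ 1')(b ⊗ 1' - 1 ⊗ b') + (1 ⊗ b')(a ⊗ 1' - 1 ⊗ a'), where
the mixed terms cancel. -/
theorem derivationPart_mul (a b : A) :
    P.derivationPart φ (a * b) = a * P.derivationPart φ b + P.derivationPart φ a * b := by
  rw [← P.leftGen_smul a (P.derivationPart φ b), ← P.rightGen_smul b (P.derivationPart φ a)]
  simp only [derivationPart, ← map_smul, ← map_add]
  refine congrArg φ (Subtype.ext ?_)
  simp only [Submodule.coe_add, Submodule.coe_smul, smul_eq_mul, mul_sub, leftGen_mul,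
    rightGen_mul, ← leftGen_mul_rightGen]
  abel

/-- Commuting 1 # x past a ⊗ 1' - 1 ⊗ a' produces the same element for {x, a}, plus (a ⊗ 1' - 1 ⊗
a')(1 # x); then apply φ. -/
theorem bracket_derivationPart (x a : A) :
    P.bracket x (P.derivationPart φ a) =
      P.derivationPart φ (P.bracket x a) + a * P.liePart φ x - P.liePart φ x * a := by
  rw [← P.leftGen_smul a, ← P.rightGen_smul a, ← P.lieGen_smul x]
  simp only [derivationPart, liePart, ← map_smul, ← map_add, ← map_sub]
  refine congrArg φ (Subtype.ext ?_)
  simp only [Submodule.coe_add, Submodule.coe_sub, Submodule.coe_smul, smul_eq_mul, mul_sub,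
    lieGen_mul_leftGen, lieGen_mul_rightGen]
  abel

theorem liePart_bracket (x y : A) :
    P.liePart φ (P.bracket x y) =
      P.bracket x (P.liePart φ y) - P.bracket y (P.liePart φ x) := by
  rw [← P.lieGen_smul x (P.liePart φ y), ← P.lieGen_smul y (P.liePart φ x)]
  simp only [liePart, ← map_smul, ← map_sub]
  refine congrArg φ (Subtype.ext ?_)
  simp only [Submodule.coe_sub, Submodule.coe_smul, smul_eq_mul, lieGen_bracket]

variable {φ} in
-- The locus where two maps agree is a submodule, so it suffices that it contains the generators of
-- the annihilator.
theorem annOne_hom_ext {ψ : P.annOne →ₗ[P.Envelope] A}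
    (h : ∀ a, P.derivationPart φ a = P.derivationPart ψ a)
    (h' : ∀ x, P.liePart φ x = P.liePart ψ x) : φ = ψ := by
  have hle : P.annOne ≤ (LinearMap.eqLocus φ ψ).map P.annOne.subtype :=
    P.annOne_le (fun a => ⟨_, h a, rfl⟩) (fun x => ⟨_, h' x, rfl⟩)
  ext q
  obtain ⟨q', hq', hqq'⟩ := hle q.2
  rwa [Subtype.ext hqq'] at hq'

end Restriction

/-! ### Self-extensions of the regular module built from a pair (D, f). -/

/-- The left action of `A` on the extension `A ⊕ A`. -/
noncomputable def extLeft (K : Type u) (A : Type v) [Field K] [Ring A] [Algebra K A] :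
    A →ₐ[K] Module.End K (A × A) :=
  AlgHom.ofLinearMap
    (LinearMap.mk₂ K (fun a v => (a * v.1, a * v.2))
      (fun a b v => by simp [add_mul]) (fun c a v => by simp)
      (fun a v w => by simp [mul_add]) (fun c a v => by simp))
    (by ext <;> simp) (fun a b => by ext <;> simp [mul_assoc])

/-- The right action of `A` on the extension `A ⊕ A` twisted by a derivation `D`. -/
noncomputable def extRight (D : A →ₗ[K] A) (hD : ∀ a b, D (a * b) = a * D b + D a * b) :
    Aᵐᵒᵖ →ₐ[K] Module.End K (A × A) :=
  AlgHom.ofLinearMap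
    -- The sign is chosen so that a ⊗ 1' - 1 ⊗ a' sends (0, 1) to (D a, 0).
    (LinearMap.mk₂ K (fun b v => (v.1 * b.unop - v.2 * D b.unop, v.2 * b.unop))
      (fun a b v => by ext <;> simp [mul_add]; abel) (fun c a v => by simp [smul_sub])
      (fun a v w => by ext <;> simp [add_mul]; abel) (fun c a v => by simp [smul_sub]))
    (by
      have h1 : D 1 = 0 := by simpa using hD 1 1
      ext <;> simp [h1])
    (fun a b => by
      apply LinearMap.ext
      intro v
      ext
      · simp [hD, sub_mul, mul_add, mul_assoc]; abel
      · simp [mul_assoc])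

/-- The action of the Lie algebra `A` on the extension `A ⊕ A` twisted by `f`. -/
noncomputable def extLie (f : A →ₗ[K] A)
    (hf : ∀ x y, f (P.bracket x y) = P.bracket x (f y) - P.bracket y (f x)) :
    P.LieAlg →ₗ⁅K⁆ Module.End K (A × A) :=
  { (LinearMap.mk₂ K (fun (x : A) (v : A × A) => (P.bracket x v.1 + v.2 * f x, P.bracket x v.2))
      (fun a b v => by ext <;> simp [mul_add]; abel) (fun c a v => by simp [smul_add])
      (fun a v w => by ext <;> simp [add_mul]; abel) (fun c a v => by simp [smul_add]) :
      A →ₗ[K] Module.End K (A × A)) with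
    map_lie' := fun {x y} => by
      rw [LieRing.of_associative_ring_bracket]
      apply LinearMap.ext
      rintro ⟨m, n⟩
      have h : ∀ x y : A, f (P.bracket x y) = P.bracket x (f y) - P.bracket y (f x) := hf
      revert x y
      change ∀ x y : A, _
      intro x y
      ext
      · change P.bracket (P.bracket x y) m + n * f (P.bracket x y) =
          (P.bracket x (P.bracket y m + n * f y) + P.bracket y n * f x) -
          (P.bracket y (P.bracket x m + n * f x) + P.bracket x n * f y)
        -- Only this coordinate needs the cocycle condition on f; the terms {x, n} f y and {y, n} f
        -- x cancel by the Leibniz rule.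
        simp only [map_add, P.leibniz, h, P.jacobi x y m, mul_sub]
        abel
      · change P.bracket (P.bracket x y) n =
          P.bracket x (P.bracket y n) - P.bracket y (P.bracket x n)
        rw [P.jacobi x y n]; abel }

/-- Every derivation `D` together with a compatible map `f` comes from a `Q(A)`-linear map on
the annihilator of `1`. -/
theorem exists_annOne_hom (D f : A →ₗ[K] A) (hD : ∀ a b, D (a * b) = a * D b + D a * b)
    (hDf : ∀ x a, P.bracket x (D a) = D (P.bracket x a) + a * f x - f x * a)
    (hf : ∀ x y, f (P.bracket x y) = P.bracket x (f y) - P.bracket y (f x)) :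
    ∃ φ : P.annOne →ₗ[P.Envelope] A,
      (∀ a, P.derivationPart φ a = D a) ∧ ∀ x, P.liePart φ x = f x := by
  let σ : A ⊗[K] Aᵐᵒᵖ →ₐ[K] Module.End K (A × A) :=
    Algebra.TensorProduct.lift (extLeft K A) (extRight D hD) (fun a b => by
      apply LinearMap.ext
      intro v
      ext <;> simp [extLeft, extRight, mul_assoc, mul_sub])
  have hσ : ∀ a b m n, σ (a ⊗ₜ MulOpposite.op b) (m, n) =
      (a * (m * b - n * D b), a * (n * b)) := fun a b m n => by
    simp [σ, extLeft, extRight]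
  have compat : ∀ (x : P.LieAlg) (r : A ⊗[K] Aᵐᵒᵖ),
      P.extLie f hf x * σ r = σ (P.envAction.act x r) + σ r * P.extLie f hf x := by
    change ∀ x : A, _
    intro x r
    have hτx : ∀ m n, P.extLie f hf x (m, n) =
      (P.bracket x m + n * f x, P.bracket x n) := fun m n => rfl
    induction r with
    | zero => simp
    | add r s hr hs => simp only [map_add, mul_add, add_mul, hr, hs]; abel
    | tmul a b =>
      apply LinearMap.ext
      rintro ⟨m, n⟩
      obtain ⟨b, rfl⟩ := MulOpposite.op_surjective b
      rw [P.envAction_act_tmul x a b]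
      simp only [Module.End.mul_apply, LinearMap.add_apply, map_add, hσ, hτx, Prod.mk_add_mk]
      ext
      -- The twist by D produces {x, D b}, and `hDf` is exactly what matches it with the twist by f.
      · simp only [P.leibniz, map_sub, hDf, mul_add, mul_sub, add_mul, mul_assoc]
        abel
      · simp only [P.leibniz, mul_add]
        abel
  let ρ : P.Envelope →ₐ[K] Module.End K (A × A) := P.envAction.smashLift σ (P.extLie f hf) compat
  have hl : ∀ a m n, ρ (P.leftGen a) (m, n) = (a * m, a * n) := fun a m n => by
    have h := hσ a 1 m n
    have h1 : D 1 = 0 := by simpa using hD 1 1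
    rw [h1] at h
    simpa [ρ, leftGen_apply, DerivationAction.smashLift_smash] using h
  have hr : ∀ b m n, ρ (P.rightGen b) (m, n) = (m * b - n * D b, n * b) := fun b m n => by
    have h := hσ 1 b m n
    simpa [ρ, rightGen_apply, DerivationAction.smashLift_smash] using h
  have hx : ∀ x m n, ρ (P.lieGen x) (m, n) = (P.bracket x m + n * f x, P.bracket x n) :=
    fun x m n => by
      rw [lieGen_apply]
      simp only [ρ, DerivationAction.smashLift_smash, map_one, one_mul]
      exact LinearMap.congr_fun
        (UniversalEnvelopingAlgebra.lift_ι_apply K (P.extLie f hf) (show P.LieAlg from x)) (m, n)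
  -- A ⊕ 0 is a submodule, and both it and the quotient by it are the regular module.
  have hρ : ∀ q : P.Envelope, (∀ v, (ρ q v).2 = q • v.2) ∧ ∀ m, ρ q (m, 0) = (q • m, 0) := by
    intro q
    induction q using P.envelope_induction with
    | left a => simp [hl, leftGen_smul]
    | right b => simp [hr, rightGen_smul]
    | lie x => simp [hx, lieGen_smul]
    | add a b ha hb => simp [ha, hb, add_smul]
    | mul a b ha hb => simp [ha, hb, mul_smul]
  -- The vector (0, 1) lifts 1 in the quotient, so any q killing 1 moves it into A ⊕ 0. This makes
  -- the first coordinate Q(A)-linear on the annihilator.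
  refine ⟨{ toFun := fun q => (ρ q (0, 1)).1, map_add' := fun q r => by simp,
            map_smul' := fun r q => ?_ }, fun a => ?_, fun x => ?_⟩
  · have hq : ρ q (0, 1) = ((ρ q (0, 1)).1, 0) :=
      Prod.ext rfl (((hρ q).1 (0, 1)).trans (P.mem_annOne.1 q.2))
    rw [Submodule.coe_smul, smul_eq_mul, map_mul, Module.End.mul_apply, hq, (hρ r).2]
    rfl
  · change (ρ (P.leftGen a - P.rightGen a) (0, 1)).1 = D a
    simp [hl, hr]
  · change (ρ (P.lieGen x) (0, 1)).1 = f x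
    simp [hx]

end PoissonStructure

end ExtensionModule

/-! ### Hochschild cocycles and coboundaries in degree one. -/

namespace Hochschild

variable {K : Type u} {A : Type v} [Field K] [Ring A] [Algebra K A]

/-- A linear endomorphism of `A` as a Hochschild `1`-cochain. -/
def ofLinear (K : Type u) (A : Type v) [Field K] [Ring A] [Algebra K A] :
    (A →ₗ[K] A) ≃ₗ[K] Cochain K A 1 :=
  MultilinearMap.ofSubsingletonₗ K K A A (0 : Fin 1)

theorem ofLinear_apply (D : A →ₗ[K] A) (a : Fin 1 → A) : ofLinear K A D a = D (a 0) := rfl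

/-- The `1`-cocycles are the derivations. -/
theorem ofLinear_mem_ker {D : A →ₗ[K] A} :
    ofLinear K A D ∈ LinearMap.ker (differential K A 1) ↔
      ∀ a b, D (a * b) = a * D b + D a * b := by
  have key : ∀ a : Fin 2 → A, differential K A 1 (ofLinear K A D) a =
      a 0 * D (a 1) - D (a 0 * a 1) + D (a 0) * a 1 := by
    intro a
    rw [differential_apply]
    simp [ofLinear_apply, Fin.contractNth, sub_eq_add_neg]
  rw [LinearMap.mem_ker]
  constructor
  · intro h a b
    have h' := key ![a, b]
    rw [h] at h'
    simp only [zero_apply, Matrix.cons_val_zero, Matrix.cons_val_one] at h'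
    rw [eq_comm, sub_add_eq_add_sub, sub_eq_zero] at h'
    exact h'.symm
  · intro h
    ext a
    rw [key, h, zero_apply]
    abel

/-- The `1`-coboundaries are the inner derivations. -/
theorem ofLinear_mem_coboundaries {D : A →ₗ[K] A} :
    ofLinear K A D ∈ coboundaries K A 1 ↔ ∃ m, ∀ a, D a = a * m - m * a := by
  have key : ∀ (f : Cochain K A 0) (a : Fin 1 → A), differential K A 0 f a =
      a 0 * f ![] - f ![] * a 0 := by
    intro f a
    rw [differential_apply]
    have h : ∀ g : Fin 0 → A, f g = f ![] := fun g => congrArg f (Subsingleton.elim _ _)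
    rw [h, h fun i => a i.castSucc]
    simp [sub_eq_add_neg]
  constructor
  · rintro ⟨f, hf⟩
    refine ⟨f ![], fun a => ?_⟩
    rw [← key f (fun _ => a), hf, ofLinear_apply]
  · rintro ⟨m, hm⟩
    refine ⟨MultilinearMap.constOfIsEmpty K _ m, ?_⟩
    ext a
    rw [key, ofLinear_apply, hm]
    rfl

end Hochschild

/-! ### Derivation part and central part for the standard structure. -/

namespace PoissonStructure

open scoped ModuleCat

section

variable {K : Type u} {A : Type v} [Field K] [Ring A] [Algebra K A] (P : PoissonStructure K A)

/-- The derivation part of a `Q(A)`-linear map on the annihilator of `1`, as a linear map. -/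
noncomputable def derivationPartₗ (φ : P.annOne →ₗ[P.Envelope] A) : A →ₗ[K] A where
  toFun := P.derivationPart φ
  map_add' := P.derivationPart_add φ
  map_smul' := P.derivationPart_smul φ

/-- The Lie part of a `Q(A)`-linear map on the annihilator of `1`, as a linear map. -/
noncomputable def liePartₗ (φ : P.annOne →ₗ[P.Envelope] A) : A →ₗ[K] A where
  toFun := P.liePart φ
  map_add' := P.liePart_add φ
  map_smul' := P.liePart_smul φ

end

section Standard

theorem standard_bracket {K : Type u} {A : Type v} [Field K] [Ring A] [Algebra K A] (l : K)
    (a b : A) : (standard K A l).bracket a b = l • (a * b - b * a) := rfl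

variable {K A : Type u} [Field K] [Ring A] [Algebra K A] {l : K}

/-- In l[x, D a] = l D[x, a] + [a, f x], expanding D[x, a] by the Leibniz rule cancels l[x, D a] and
leaves [a, f x] = l[a, D x]. -/
theorem liePart_sub_mem_center
    (φ : (standard K A l).annOne →ₗ[(standard K A l).Envelope] A) (x : A) :
    (standard K A l).liePart φ x - l • (standard K A l).derivationPart φ x ∈
      Subalgebra.center K A := by
  rw [Subalgebra.mem_center_iff]
  intro a
  have h := (standard K A l).bracket_derivationPart φ x a
  have hD := (standard K A l).derivationPart_mul φ
  have hsub : (standard K A l).derivationPart φ (x * a - a * x) =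
      (standard K A l).derivationPart φ (x * a) - (standard K A l).derivationPart φ (a * x) :=
    map_sub ((standard K A l).derivationPartₗ φ) _ _
  rw [standard_bracket, standard_bracket, derivationPart_smul, hsub, hD, hD,
    add_sub_assoc, ← sub_eq_iff_eq_add'] at h
  rw [← sub_eq_zero, mul_sub, sub_mul, sub_sub_sub_comm, ← h, mul_smul_comm, smul_mul_assoc,
    ← smul_sub, ← smul_sub, ← smul_sub]
  rw [smul_eq_zero]
  right
  abel

/-- Cancelling one factor l in the cocycle identity gives f[x, y] = [x, f y] - [y, f x]. Inside
commutators f may be replaced by lD, as the difference is central, and the right side becomes l D[x,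
y]. -/
theorem liePart_sub_commutator (hl : l ≠ 0)
    (φ : (standard K A l).annOne →ₗ[(standard K A l).Envelope] A) (x y : A) :
    (standard K A l).liePart φ (x * y - y * x) -
      l • (standard K A l).derivationPart φ (x * y - y * x) = 0 := by
  have hsub : (standard K A l).derivationPart φ (x * y - y * x) =
      (standard K A l).derivationPart φ (x * y) - (standard K A l).derivationPart φ (y * x) :=
    map_sub ((standard K A l).derivationPartₗ φ) _ _
  have hc : ∀ a b, a * (standard K A l).liePart φ b - (standard K A l).liePart φ b * a =
      l • (a * (standard K A l).derivationPart φ b - (standard K A l).derivationPart φ b * a) := by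
    intro a b
    have h := Subalgebra.mem_center_iff.1 (liePart_sub_mem_center φ b) a
    rwa [mul_sub, sub_mul, mul_smul_comm, smul_mul_assoc, sub_eq_sub_iff_sub_eq_sub,
      ← smul_sub] at h
  have h := (standard K A l).liePart_bracket φ x y
  rw [standard_bracket, standard_bracket, standard_bracket, liePart_smul, ← smul_sub] at h
  rw [smul_right_injective A hl h, hsub, (standard K A l).derivationPart_mul,
    (standard K A l).derivationPart_mul, hc, hc,
    ← smul_sub, ← smul_sub, smul_eq_zero]
  right
  abel

/-- The central part of a `Q(A)`-linear map on the annihilator of `1`, for the standard Poisson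
structure. -/
noncomputable def centralPart (hl : l ≠ 0)
    (φ : (standard K A l).annOne →ₗ[(standard K A l).Envelope] A) :
    (A ⧸ commutatorSubspace K A) →ₗ[K] Subalgebra.center K A :=
  (commutatorSubspace K A).liftQ
    (((standard K A l).liePartₗ φ - l • (standard K A l).derivationPartₗ φ).codRestrict
      (Subalgebra.toSubmodule (Subalgebra.center K A)) (liePart_sub_mem_center φ))
    (Submodule.span_le.2 (by
      rintro _ ⟨x, y, rfl⟩
      exact Subtype.ext (liePart_sub_commutator hl φ x y)))

/-- The derivation part as a Hochschild cocycle. -/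
noncomputable def cocyclePart (φ : (standard K A l).annOne →ₗ[(standard K A l).Envelope] A) :
    LinearMap.ker (Hochschild.differential K A 1) :=
  ⟨Hochschild.ofLinear K A ((standard K A l).derivationPartₗ φ),
    Hochschild.ofLinear_mem_ker.2 ((standard K A l).derivationPart_mul φ)⟩

/-- The linear map sending a `Q(A)`-linear map on the annihilator of `1` to the class of its
derivation part and its central part. -/
noncomputable def partsMap (hl : l ≠ 0) :
    (ModuleCat.of (standard K A l).Envelope (standard K A l).annOne ⟶
      ModuleCat.of (standard K A l).Envelope A) →ₗ[K]
      Hochschild.HH K A 1 × ((A ⧸ commutatorSubspace K A) →ₗ[K] Subalgebra.center K A) where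
  toFun φ := (Submodule.Quotient.mk (cocyclePart φ.hom), centralPart hl φ.hom)
  map_add' φ ψ := by
    refine Prod.ext ?_ ?_
    · exact congrArg Submodule.Quotient.mk (Subtype.ext (MultilinearMap.ext fun a => rfl))
    · apply LinearMap.ext
      rintro ⟨x⟩
      refine Subtype.ext ?_
      change (φ.hom _ + ψ.hom _) - l • (φ.hom _ + ψ.hom _) =
        (φ.hom _ - l • φ.hom _) + (ψ.hom _ - l • ψ.hom _)
      rw [smul_add]; abel
  map_smul' c φ := by
    -- Scalars act on morphisms of Q(A)-modules through K → Q(A).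
    have h : ∀ q, (c • φ).hom q = c • φ.hom q :=
      fun q => (standard K A l).algebraMap_envelope_smul c (φ.hom q)
    refine Prod.ext ?_ ?_
    · exact congrArg Submodule.Quotient.mk (Subtype.ext (MultilinearMap.ext fun a => h _))
    · apply LinearMap.ext
      rintro ⟨x⟩
      refine Subtype.ext ?_
      change (c • φ).hom _ - l • (c • φ).hom _ = c • (φ.hom _ - l • φ.hom _)
      rw [h, h, smul_sub, smul_comm]

/-- Given a derivation D and a central-valued γ vanishing on commutators, the pair (D, γ + lD)
satisfies all the relations: lD alone does, and γ drops out of every commutator. -/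
theorem partsMap_surjective (hl : l ≠ 0) : Function.Surjective (partsMap (A := A) hl) := by
  rintro ⟨c, g⟩
  obtain ⟨⟨f, hf⟩, rfl⟩ := Submodule.Quotient.mk_surjective _ c
  obtain ⟨D, rfl⟩ := (Hochschild.ofLinear K A).surjective f
  have hD := Hochschild.ofLinear_mem_ker.1 hf
  let γ : A →ₗ[K] A := (Subalgebra.center K A).val.toLinearMap ∘ₗ g ∘ₗ
    (commutatorSubspace K A).mkQ
  have hγ : ∀ x a, a * γ x = γ x * a := fun x a => Subalgebra.mem_center_iff.1 (g _).2 a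
  have hγ' : ∀ x y, γ (x * y - y * x) = 0 := by
    intro x y
    have : (commutatorSubspace K A).mkQ (x * y - y * x) = 0 :=
      (Submodule.Quotient.mk_eq_zero _).2 (Submodule.subset_span ⟨x, y, rfl⟩)
    simp only [γ, LinearMap.comp_apply, this, map_zero]
  obtain ⟨φ, h1, h2⟩ := (standard K A l).exists_annOne_hom D (γ + l • D) hD
    (by
      intro x a
      simp only [standard_bracket, map_smul, map_sub, hD, LinearMap.add_apply,
        LinearMap.smul_apply, mul_add, add_mul, hγ, mul_smul_comm, smul_mul_assoc, smul_sub,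
        smul_add]
      abel)
    (by
      intro x y
      simp only [standard_bracket, map_smul, LinearMap.add_apply, map_sub,
        LinearMap.smul_apply, mul_add, add_mul, hγ, hD, mul_smul_comm, smul_mul_assoc, smul_sub,
        smul_add]
      have := hγ' x y
      rw [map_sub, sub_eq_zero] at this
      rw [this]
      abel)
  refine ⟨ModuleCat.ofHom φ, Prod.ext ?_ ?_⟩
  · refine congrArg Submodule.Quotient.mk (Subtype.ext ?_)
    exact MultilinearMap.ext fun a => h1 (a 0)
  · apply LinearMap.ext
    rintro ⟨x⟩
    refine Subtype.ext ?_
    change (standard K A l).liePart φ x - l • (standard K A l).derivationPart φ x = γ x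
    rw [h1, h2]
    simp

/-- For q ↦ q m one has D = [·, m] and f = {·, m} = lD. Conversely, if D = [·, m] and f = lD, then φ
agrees with q ↦ q m on generators, hence everywhere. -/
theorem partsMap_eq_zero_iff (hl : l ≠ 0)
    (φ : ModuleCat.of (standard K A l).Envelope (standard K A l).annOne ⟶
      ModuleCat.of (standard K A l).Envelope A) :
    partsMap hl φ = 0 ↔ ∃ m : A, ∀ q, φ.hom q = (q : (standard K A l).Envelope) • m := by
  have h1 : partsMap hl φ = 0 ↔
      (∃ m, ∀ a, (standard K A l).derivationPart φ.hom a = a * m - m * a) ∧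
      ∀ x, (standard K A l).liePart φ.hom x = l • (standard K A l).derivationPart φ.hom x := by
    rw [Prod.ext_iff]
    refine and_congr ?_ ?_
    · exact (Submodule.Quotient.mk_eq_zero _).trans Hochschild.ofLinear_mem_coboundaries
    · constructor
      · intro h x
        have h' := congrArg Subtype.val (LinearMap.congr_fun h (Submodule.Quotient.mk x))
        exact sub_eq_zero.1 h'
      · intro h
        apply LinearMap.ext
        rintro ⟨x⟩
        exact Subtype.ext (sub_eq_zero.2 (h x))
  have h2 : ∀ m : A, (∀ q, φ.hom q = (q : (standard K A l).Envelope) • m) ↔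
      (∀ a, (standard K A l).derivationPart φ.hom a = a * m - m * a) ∧
        ∀ x, (standard K A l).liePart φ.hom x = (standard K A l).bracket x m := by
    intro m
    constructor
    · intro h
      refine ⟨fun a => ?_, fun x => ?_⟩
      · rw [derivationPart, h, sub_smul, leftGen_smul, rightGen_smul]
      · rw [liePart, h, lieGen_smul]
    · rintro ⟨ha, hx⟩
      let ψ : (standard K A l).annOne →ₗ[(standard K A l).Envelope] A :=
        (LinearMap.toSpanSingleton (standard K A l).Envelope A m).comp (standard K A l).annOne.subtype
      have hφ : φ.hom = ψ := by
        refine (standard K A l).annOne_hom_ext (fun a => ?_) (fun x => ?_)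
        · rw [ha, ← (standard K A l).leftGen_smul, ← (standard K A l).rightGen_smul, ← sub_smul]
          rfl
        · rw [hx, ← (standard K A l).lieGen_smul]; rfl
      intro q
      rw [hφ]; rfl
  rw [h1]
  constructor
  · rintro ⟨⟨m, hm⟩, hx⟩
    exact ⟨m, (h2 m).2 ⟨hm, fun x => by rw [hx, hm, standard_bracket]⟩⟩
  · rintro ⟨m, h⟩
    obtain ⟨hm, hx⟩ := (h2 m).1 h
    exact ⟨⟨m, hm⟩, fun x => by rw [hx, hm, standard_bracket]⟩

end Standard

end PoissonStructure

theorem mainTheorem10 {K A : Type u} [Field K] [CharZero K] [Ring A] [Algebra K A]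
    (l : K) (hl : l ≠ 0) :
    Nonempty ((PoissonStructure.standard K A l).HQ 1
        (ModuleCat.of (PoissonStructure.standard K A l).Envelope A) ≃ₗ[K]
      Hochschild.HH K A 1 ×
        ((A ⧸ commutatorSubspace K A) →ₗ[K] Subalgebra.center K A)) := by
  obtain ⟨δ, hδ, hker⟩ := exists_ext_one_of_cyclic (k := K)
    (Q := (PoissonStructure.standard K A l).Envelope)
    (1 : A) (fun m => ⟨(PoissonStructure.standard K A l).leftGen m, by
      rw [LinearMap.toSpanSingleton_apply, PoissonStructure.leftGen_smul, mul_one]⟩)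
    (ModuleCat.of (PoissonStructure.standard K A l).Envelope A)
  -- Both targets are quotients of the same Hom space by the maps q ↦ q m.
  have h : LinearMap.ker δ = LinearMap.ker (PoissonStructure.partsMap hl) := by
    apply Submodule.ext
    intro φ
    rw [LinearMap.mem_ker, LinearMap.mem_ker, PoissonStructure.partsMap_eq_zero_iff]
    exact hker φ
  have e₁ := δ.quotKerEquivOfSurjective hδ
  have e₂ := (PoissonStructure.partsMap (A := A) hl).quotKerEquivOfSurjective
    (PoissonStructure.partsMap_surjective hl)
  exact ⟨e₁.symm.trans ((Submodule.quotEquivOfEq _ _ h).trans e₂)⟩
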